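/- Let $\mathbb{H}$ be the real algebra of quaternions and $\mathbb{S}=\{I\in\mathbb{H}: I^2=-1\}$. A real differentiable function $f:\mathbb{H}\to\mathbb{H}$ is called (slice-)regular if for every $I\in\mathbb{S}$ and all $x,y\in\mathbb{R}$ $$\frac12\left(\frac{\partial}{\partial x}+I\frac{\partial}{\partial y}\right)f(x+Iy)=0 .$$ It is called biregular if it is regular and has a two-sided inverse $\mathbb{H}\to\mathbb{H}$ that is regular as well. (1) A function $f:\mathbb{H}\to\mathbb{H}$ is regular and injective if and only if there exist $a,b\in\mathbb{H}$ with $a\neq 0$ such that $f(q)=qa+b$ for all $q\in\mathbb{H}$. (2) A function $f:\mathbb{H}\to\mathbb{H}$ is biregular if and only if it is a regular affine transformation, i.e. of the form $f(q)=qa+b$ with $a,b\in\mathbb{H}$, $a\neq0$. Hence the set $\mathrm{Aut}(\mathbb{H})$ of biregular functions is a group under composition, and it coincides with the group $\mathcal{A}$ of regular affine transformations. -/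

import Mathlib

open scoped Quaternion

noncomputable section

namespace SliceRegular

/-- The sphere `𝕊 = {I ∈ ℍ : I² = -1}` of quaternionic imaginary units. -/
def imaginaryUnits : Set ℍ[ℝ] := {I | I ^ 2 = -1}

/-- The operator `(1/2) (∂/∂x + I ∂/∂y)` applied to the restriction of `f` to the complex line
`ℝ + I ℝ`, evaluated at the point `x + I y`. -/
def dbar (I : ℍ[ℝ]) (f : ℍ[ℝ] → ℍ[ℝ]) (x y : ℝ) : ℍ[ℝ] :=
  (1 / 2 : ℝ) •
    (deriv (fun t : ℝ => f ((t : ℍ[ℝ]) + I * (y : ℍ[ℝ]))) x +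
      I * deriv (fun t : ℝ => f ((x : ℍ[ℝ]) + I * (t : ℍ[ℝ]))) y)

/-- (Slice-)regular functions on the whole of `ℍ`: real differentiable functions whose restriction
to every complex line `ℝ + I ℝ` is holomorphic. -/
def IsSliceRegular (f : ℍ[ℝ] → ℍ[ℝ]) : Prop :=
  Differentiable ℝ f ∧ ∀ I ∈ imaginaryUnits, ∀ x y : ℝ, dbar I f x y = 0

/-- Biregular functions `ℍ → ℍ`: regular functions having a regular (two-sided) inverse. -/
def IsBiregular (f : ℍ[ℝ] → ℍ[ℝ]) : Prop :=
  IsSliceRegular f ∧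
    ∃ g : ℍ[ℝ] → ℍ[ℝ], IsSliceRegular g ∧ Function.LeftInverse g f ∧ Function.RightInverse g f

/-- Regular affine transformations `q ↦ q a + b` with `a ≠ 0`. -/
def IsRegularAffine (f : ℍ[ℝ] → ℍ[ℝ]) : Prop :=
  ∃ a b : ℍ[ℝ], a ≠ 0 ∧ ∀ q : ℍ[ℝ], f q = q * a + b

/-- `Aut(ℍ)`, as a set of permutations of `ℍ`. -/
def aut : Set (Equiv.Perm ℍ[ℝ]) := {e | IsBiregular e}

/-- The group `𝒜` of regular affine transformations, under composition. -/
def affineGroup : Subgroup (Equiv.Perm ℍ[ℝ]) where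
  carrier := {e | IsRegularAffine e}
  one_mem' := ⟨1, 0, one_ne_zero, fun q => by simp⟩
  mul_mem' := by
    rintro e e' ⟨a, b, ha, h⟩ ⟨a', b', ha', h'⟩
    refine ⟨a' * a, b' * a + b, mul_ne_zero ha' ha, fun q => ?_⟩
    rw [Equiv.Perm.mul_apply, h, h', add_mul, mul_assoc, add_assoc]
  inv_mem' := by
    rintro e ⟨a, b, ha, h⟩
    refine ⟨a⁻¹, -(b * a⁻¹), inv_ne_zero ha, fun q => ?_⟩
    rw [Equiv.Perm.inv_eq_iff_eq, h, add_mul, neg_mul, inv_mul_cancel_right₀ ha,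
      inv_mul_cancel_right₀ ha, neg_add_cancel_right]

end SliceRegular

end

/-!
In real coordinates on `ℍ`, a regular function `f` has a stem function `(F₁, …, F₄) : ℂ → ℂ⁴`,
entire and real on the real axis. For a real point `t`, the symmetrization `∑ (Fₖ - Fₖ(t))²` of
`f - f(t)` vanishes at `x + iy` only if `f` takes the value `f(t)` on the sphere `x + 𝕊y`; so if `f`
is injective, `t` is its only zero. By Hurwitz's theorem, every value close to `f(t)` is attained
close to `t`, hence, again by injectivity, nowhere else: `f - f(t)` is bounded away from zero far
from `t`, and so is its symmetrization. If `f'(t) ≠ 0`, the quotient of `(z - t)²` by the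
symmetrization is therefore entire, zero-free and of at most quadratic growth, hence constant. On
the real axis this reads `|f(s) - f(t)| = |f'(t)| |s - t|`. Two such points `t` force `f` to be
affine on `ℝ`, and the identity principle propagates this to `ℍ`.
-/

section EntireFunctions

open Bornology Asymptotics Filter Polynomial Topology

theorem differentiable_dslope {E : Type*} [NormedAddCommGroup E] [NormedSpace ℂ E]
    [CompleteSpace E] {g : ℂ → E} (hg : Differentiable ℂ g) (c : ℂ) :
    Differentiable ℂ (dslope g c) :=
  differentiableOn_univ.1 ((Complex.differentiableOn_dslope univ_mem).2 hg.differentiableOn)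

theorem eq_of_forall_ofReal_eq {E : Type*} [NormedAddCommGroup E] [NormedSpace ℂ E]
    [CompleteSpace E] {g h : ℂ → E} (hg : Differentiable ℂ g) (hh : Differentiable ℂ h)
    (H : ∀ t : ℝ, g t = h t) : g = h := by
  have hofReal : Tendsto ((↑) : ℝ → ℂ) (𝓝[≠] 0) (𝓝[≠] 0) := by
    simpa only [Complex.ofRealCLM_apply, Complex.ofReal_zero] using!
      (Complex.ofRealCLM.hasDerivAt (x := 0)).tendsto_nhdsNE (by simp)
  exact AnalyticOnNhd.eq_of_frequently_eq (fun z _ => hg.analyticAt z) (fun z _ => hh.analyticAt z)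
    (hofReal.frequently (Eventually.of_forall H).frequently)

theorem exists_differentiable_forall_ofReal_eq_re {g : ℂ → ℂ} (hg : Differentiable ℂ g) :
    ∃ F : ℂ → ℂ, Differentiable ℂ F ∧ ∀ t : ℝ, F t = (g t).re := by
  refine ⟨fun z => (g z + starRingEnd ℂ (g (starRingEnd ℂ z))) / 2, ?_, fun t => ?_⟩
  · have hconj : Differentiable ℂ fun z => starRingEnd ℂ (g (starRingEnd ℂ z)) := fun z =>
      differentiableAt_conj_conj_iff.2 (hg (starRingEnd ℂ z))
    exact (hg.add hconj).div_const 2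
  · simp only [Complex.conj_ofReal, Complex.re_eq_add_conj]

theorem apply_eq_apply_of_isBigO_one {E : Type*} [NormedAddCommGroup E] [NormedSpace ℂ E]
    {g : ℂ → E} (hg : Differentiable ℂ g) (hO : g =O[cobounded ℂ] fun _ => (1 : ℝ)) (z w : ℂ) :
    g z = g w := by
  obtain ⟨M, hM⟩ := (isBigO_one_iff ℝ).1 hO
  have hK : IsBounded {z | ‖g z‖ ≤ M}ᶜ := isBounded_def.2 (by simpa using! hM)
  have himage : IsBounded (g '' closure {z | ‖g z‖ ≤ M}ᶜ) :=
    (hK.isCompact_closure.image hg.continuous).isBounded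
  have hball : IsBounded (Metric.closedBall (0 : E) M) := Metric.isBounded_closedBall
  refine hg.apply_eq_apply_of_bounded ((himage.union hball).subset ?_) z w
  rintro _ ⟨x, rfl⟩
  by_cases hx : ‖g x‖ ≤ M
  · exact Or.inr (mem_closedBall_zero_iff.2 hx)
  · exact Or.inl ⟨x, subset_closure hx, rfl⟩

theorem exists_polynomial_of_isBigO_pow {g : ℂ → ℂ} (hg : Differentiable ℂ g) {n : ℕ}
    (hO : g =O[cobounded ℂ] (· ^ n)) : ∃ p : ℂ[X], ∀ z, g z = p.eval z := by
  induction n generalizing g with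
  | zero =>
    exact ⟨C (g 0), fun z => by
      rw [eval_C, apply_eq_apply_of_isBigO_one hg (by simpa using hO.norm_right)]⟩
  | succ n ih =>
    have hsub : (fun z => g z - g 0) =O[cobounded ℂ] fun z => z * z ^ n := by
      have hconst := (isLittleO_pow_pow_cobounded_of_lt (R := ℂ) n.succ_pos).isBigO
      simp only [pow_zero] at hconst
      simpa only [pow_succ'] using hO.sub ((isBigO_const_const _ one_ne_zero _).trans hconst)
    have hdslope : dslope g 0 =O[cobounded ℂ] (· ^ n) := by
      have hne : ∀ᶠ z : ℂ in cobounded ℂ, z ≠ 0 := eventually_ne_cobounded 0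
      refine ((isBigO_refl (·⁻¹) _).mul hsub).congr' ?_ ?_
      · filter_upwards [hne] with z hz
        rw [dslope_of_ne g hz, slope_def_field, sub_zero, inv_mul_eq_div]
      · filter_upwards [hne] with z hz
        exact inv_mul_cancel_left₀ hz _
    obtain ⟨p, hp⟩ := ih (differentiable_dslope hg 0) hdslope
    refine ⟨C (g 0) + X * p, fun z => ?_⟩
    have := sub_smul_dslope g 0 z
    rw [sub_zero, smul_eq_mul, hp] at this
    simp [this]

theorem apply_eq_apply_of_ne_zero_of_isBigO_pow {g : ℂ → ℂ} (hg : Differentiable ℂ g)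
    (h0 : ∀ z, g z ≠ 0) {n : ℕ} (hO : g =O[cobounded ℂ] (· ^ n)) (z w : ℂ) : g z = g w := by
  obtain ⟨p, hp⟩ := exists_polynomial_of_isBigO_pow hg hO
  have hdeg : p.degree = 0 := by
    by_contra h
    obtain ⟨x, hx⟩ := IsAlgClosed.exists_root p h
    exact h0 x ((hp x).trans hx)
  rw [hp, hp, eq_C_of_degree_eq_zero hdeg, eval_C, eval_C]

theorem eventually_exists_mem_closedBall_eq_zero {X : Type*} [TopologicalSpace X]
    {N : X → ℂ → ℂ} (hN : Continuous fun p : X × ℂ => N p.1 p.2) (hd : ∀ c, Differentiable ℂ (N c))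
    {c₀ : X} {z₀ : ℂ} {r : ℝ} (hr : 0 < r) (h0 : N c₀ z₀ = 0)
    (hne : ∀ z ∈ Metric.sphere z₀ r, N c₀ z ≠ 0) :
    ∀ᶠ c in 𝓝 c₀, ∃ z ∈ Metric.closedBall z₀ r, N c z = 0 := by
  obtain ⟨w, hw, hmin⟩ := (isCompact_sphere z₀ r).exists_isMinOn
    (NormedSpace.sphere_nonempty.2 hr.le) (hd c₀).continuous.norm.continuousOn
  set ε := ‖N c₀ w‖ / 2
  have hε : 0 < ε := half_pos (norm_pos_iff.2 (hne w hw))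
  have hcenter : ∀ᶠ c in 𝓝 c₀, ‖N c z₀‖ < ε / 2 := by
    have : Continuous fun c => ‖N c z₀‖ := (hN.comp (Continuous.prodMk_left z₀)).norm
    exact this.continuousAt.eventually_lt_const (by simpa [h0] using hε)
  have hsphere : ∀ᶠ c in 𝓝 c₀, ∀ z ∈ Metric.sphere z₀ r, ε < ‖N c z - N c z₀‖ := by
    refine (isCompact_sphere z₀ r).eventually_forall_of_forall_eventually fun z hz => ?_
    have hcont : Continuous fun p : X × ℂ => ‖N p.1 p.2 - N p.1 z₀‖ := by fun_prop
    refine hcont.continuousAt.eventually_const_lt ?_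
    simp only [h0, sub_zero]
    exact (half_lt_self (norm_pos_iff.2 (hne w hw))).trans_le (isMinOn_iff.1 hmin z hz)
  filter_upwards [hcenter, hsphere] with c hc hcs
  have hnonconst : ∃ᶠ z in 𝓝 z₀, N c z ≠ N c z₀ := fun h => by
    have hconst : N c = fun _ => N c z₀ :=
      AnalyticOnNhd.eq_of_eventuallyEq (fun z _ => (hd c).analyticAt z) analyticOnNhd_const
        (h.mono fun _ => not_not.1)
    have := hcs w hw
    rw [hconst, sub_self, norm_zero] at this
    exact hε.not_gt this
  exact (hd c).diffContOnCl.ball_subset_image_closedBall hr (fun z hz => (hcs z hz).le) hnonconst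
    (by simpa using hc)

end EntireFunctions

theorem exists_deriv_ne_zero_of_ne {E : Type*} [NormedAddCommGroup E] [NormedSpace ℝ E]
    {g : ℝ → E} (hg : Differentiable ℝ g) {a b : ℝ} (hab : a ≤ b) (hne : g a ≠ g b) :
    ∃ t ∈ Set.Ico a b, deriv g t ≠ 0 := by
  by_contra! hderiv
  refine hne (constant_of_has_deriv_right_zero hg.continuous.continuousOn (fun t ht => ?_) b
    (Set.right_mem_Icc.2 hab)).symm
  exact (hderiv t ht ▸ (hg t).hasDerivAt).hasDerivWithinAt

section RealInnerProductSpace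

open scoped InnerProductSpace

variable {E : Type*} [NormedAddCommGroup E] [InnerProductSpace ℝ E]

theorem norm_add_mul_norm_sub_sq (x y : E) :
    (‖x + y‖ * ‖x - y‖) ^ 2 = (‖x‖ ^ 2 + ‖y‖ ^ 2) ^ 2 - (2 * ⟪x, y⟫_ℝ) ^ 2 := by
  rw [mul_pow, norm_add_sq_real, norm_sub_sq_real]
  ring

theorem sum_sq_eq_mk_norm_inner {ι : Type*} [Fintype ι] {b : ι → E}
    (hb : Orthonormal ℝ b) (w : ι → ℂ) :
    ∑ k, w k ^ 2 = ⟨‖∑ k, (w k).re • b k‖ ^ 2 - ‖∑ k, (w k).im • b k‖ ^ 2,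
      2 * ⟪∑ k, (w k).re • b k, ∑ k, (w k).im • b k⟫_ℝ⟩ := by
  simp only [← real_inner_self_eq_norm_sq, hb.inner_sum, conj_trivial]
  apply Complex.ext
  · simp only [Complex.re_sum, ← Finset.sum_sub_distrib, pow_two, Complex.mul_re]
  · simp only [Complex.im_sum, Finset.mul_sum, pow_two, Complex.mul_im]
    exact Finset.sum_congr rfl fun k _ => by ring

theorem exists_eq_smul_add_of_norm_sub_eq {g : ℝ → E} {t u A B : ℝ} (htu : t ≠ u)
    (hA : ∀ s, ‖g s - g t‖ = A * |s - t|) (hB : ∀ s, ‖g s - g u‖ = B * |s - u|) :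
    ∃ a b : E, ∀ s, g s = s • a + b := by
  have hut : u - t ≠ 0 := sub_ne_zero.2 htu.symm
  obtain rfl : A = B := by
    have h := hA u
    rw [norm_sub_rev, hB t, abs_sub_comm] at h
    exact (mul_right_cancel₀ (abs_ne_zero.2 hut) h).symm
  have hsq (s : ℝ) : ‖g s - g t‖ ^ 2 = A ^ 2 * (s - t) ^ 2 := by rw [hA, mul_pow, sq_abs]
  have hinner (s : ℝ) : ⟪g s - g t, g u - g t⟫_ℝ = A ^ 2 * (s - t) * (u - t) := by
    have h : ‖(g s - g t) - (g u - g t)‖ ^ 2 = A ^ 2 * (s - u) ^ 2 := by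
      rw [sub_sub_sub_cancel_right, hB, mul_pow, sq_abs]
    rw [norm_sub_sq_real, hsq, hsq] at h
    linear_combination -h / 2
  have hline (s : ℝ) : g s - g t = ((s - t) / (u - t)) • (g u - g t) := by
    rw [← sub_eq_zero, ← norm_eq_zero, ← sq_eq_zero_iff, norm_sub_sq_real, norm_smul, mul_pow,
      inner_smul_right, hsq, hsq, hinner, Real.norm_eq_abs, sq_abs]
    field_simp
    ring
  refine ⟨(u - t)⁻¹ • (g u - g t), g t - t • (u - t)⁻¹ • (g u - g t), fun s => ?_⟩
  rw [← sub_add_cancel (g s) (g t), hline, div_eq_mul_inv, mul_smul, sub_smul]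
  abel

end RealInnerProductSpace

namespace SliceRegular

open scoped InnerProductSpace Topology

variable {I : ℍ[ℝ]}

theorem mem_imaginaryUnits_iff : I ∈ imaginaryUnits ↔ I.re = 0 ∧ ‖I‖ = 1 := by
  have hone (h : ‖I‖ = 1) : (-1 : ℍ[ℝ]) = -(Quaternion.normSq I : ℝ) := by
    rw [Quaternion.normSq_eq_norm_mul_self, h, one_mul, Quaternion.coe_one]
  refine ⟨fun hI => ?_, fun ⟨hre, hnorm⟩ => ?_⟩
  · have hsq : I ^ 2 = -1 := hI
    have hnorm : ‖I‖ = 1 := by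
      rw [← pow_eq_one_iff_of_nonneg (norm_nonneg I) two_ne_zero, ← norm_pow, hsq, norm_neg,
        norm_one]
    exact ⟨Quaternion.sq_eq_neg_normSq.1 (hsq.trans (hone hnorm)), hnorm⟩
  · exact (Quaternion.sq_eq_neg_normSq.2 hre).trans (hone hnorm).symm

theorem mul_mul_of_mem_imaginaryUnits (hI : I ∈ imaginaryUnits) (q : ℍ[ℝ]) :
    I * (I * q) = -q := by
  rw [← mul_assoc, ← pow_two, show I ^ 2 = -1 from hI, neg_one_mul]

theorem neg_mem_imaginaryUnits (hI : I ∈ imaginaryUnits) : -I ∈ imaginaryUnits :=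
  (neg_sq I).trans hI

theorem imaginaryUnits_nonempty : imaginaryUnits.Nonempty := by
  refine ⟨((Complex.I : ℂ) : ℍ[ℝ]), ?_⟩
  change ((Complex.I : ℂ) : ℍ[ℝ]) ^ 2 = -1
  rw [pow_two, ← Quaternion.coeComplex_mul, Complex.I_mul_I]
  ext <;> simp

/-- The parametrization `x + iy ↦ x + Iy` of the slice `ℝ + Iℝ`. -/
noncomputable def sliceMap (I : ℍ[ℝ]) : ℂ →L[ℝ] ℍ[ℝ] :=
  Complex.reCLM.smulRight (1 : ℍ[ℝ]) + Complex.imCLM.smulRight I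

theorem sliceMap_apply (I : ℍ[ℝ]) (z : ℂ) : sliceMap I z = z.re • (1 : ℍ[ℝ]) + z.im • I := rfl

theorem sliceMap_one (I : ℍ[ℝ]) : sliceMap I 1 = 1 := by simp [sliceMap_apply]

theorem sliceMap_I (I : ℍ[ℝ]) : sliceMap I Complex.I = I := by simp [sliceMap_apply]

theorem sliceMap_ofReal (I : ℍ[ℝ]) (t : ℝ) : sliceMap I t = (t : ℍ[ℝ]) := by
  simp [sliceMap_apply, ← Quaternion.coe_mul_eq_smul]

theorem sliceMap_mk (I : ℍ[ℝ]) (x y : ℝ) :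
    sliceMap I ⟨x, y⟩ = (x : ℍ[ℝ]) + I * (y : ℍ[ℝ]) := by
  simp [sliceMap_apply, Quaternion.mul_coe_eq_smul, ← Quaternion.coe_mul_eq_smul]

theorem differentiable_comp_coe {E : Type*} [NormedAddCommGroup E] [NormedSpace ℝ E]
    {f : ℍ[ℝ] → E} (hf : Differentiable ℝ f) : Differentiable ℝ fun t : ℝ => f t :=
  hf.comp (Algebra.linearMap ℝ ℍ[ℝ]).toContinuousLinearMap.differentiable

theorem inner_sliceMap (hI : I ∈ imaginaryUnits) (z w : ℂ) :
    ⟪sliceMap I z, sliceMap I w⟫_ℝ = ⟪z, w⟫_ℝ := by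
  obtain ⟨hre, hnorm⟩ := mem_imaginaryUnits_iff.1 hI
  have hone : ⟪I, 1⟫_ℝ = 0 := by simpa [Quaternion.inner_def] using hre
  simp only [sliceMap_apply, inner_add_left, inner_add_right, real_inner_smul_left,
    real_inner_smul_right, real_inner_self_eq_norm_sq, real_inner_comm I 1, hone, hnorm, norm_one,
    Complex.inner, Complex.mul_re, Complex.conj_re, Complex.conj_im]
  ring

theorem norm_sliceMap (hI : I ∈ imaginaryUnits) (z : ℂ) : ‖sliceMap I z‖ = ‖z‖ := by
  rw [norm_eq_sqrt_real_inner, norm_eq_sqrt_real_inner, inner_sliceMap hI]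

theorem norm_sliceMap_sub_coe (hI : I ∈ imaginaryUnits) (z : ℂ) (t : ℝ) :
    ‖sliceMap I z - t‖ = ‖z - t‖ := by
  rw [← sliceMap_ofReal I, ← map_sub, norm_sliceMap hI]

theorem exists_sliceMap_eq (q : ℍ[ℝ]) : ∃ I ∈ imaginaryUnits, ∃ z, sliceMap I z = q := by
  by_cases him : q.im = 0
  · obtain ⟨I, hI⟩ := imaginaryUnits_nonempty
    refine ⟨I, hI, (q.re : ℂ), ?_⟩
    rw [sliceMap_ofReal]
    simpa [him] using q.re_add_im
  · have hnorm : ‖q.im‖ ≠ 0 := norm_ne_zero_iff.2 him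
    refine ⟨‖q.im‖⁻¹ • q.im, mem_imaginaryUnits_iff.2 ⟨by simp, ?_⟩, ⟨q.re, ‖q.im‖⟩, ?_⟩
    · rw [norm_smul, norm_inv, norm_norm, inv_mul_cancel₀ hnorm]
    · rw [sliceMap_mk, Quaternion.mul_coe_eq_smul, smul_inv_smul₀ hnorm, q.re_add_im]

theorem dbar_eq_smul_fderiv {f : ℍ[ℝ] → ℍ[ℝ]} (hf : Differentiable ℝ f) (I : ℍ[ℝ]) (z : ℂ) :
    dbar I f z.re z.im =
      (1 / 2 : ℝ) • (fderiv ℝ f (sliceMap I z) 1 + I * fderiv ℝ f (sliceMap I z) I) := by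
  have hx : HasDerivAt (fun t : ℝ => (⟨t, z.im⟩ : ℂ)) 1 z.re := by
    simpa [Complex.mk_eq_add_mul_I] using (Complex.ofRealCLM.hasDerivAt (x := z.re)).add_const
      (z.im * Complex.I : ℂ)
  have hy : HasDerivAt (fun t : ℝ => (⟨z.re, t⟩ : ℂ)) Complex.I z.im := by
    simpa [Complex.mk_eq_add_mul_I] using
      ((Complex.ofRealCLM.hasDerivAt (x := z.im)).mul_const Complex.I).const_add
        (z.re : ℂ)
  have hfs : HasFDerivAt (fun w => f (sliceMap I w)) (fderiv ℝ f (sliceMap I z) ∘L sliceMap I) z :=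
    (hf _).hasFDerivAt.comp z (sliceMap I).hasFDerivAt
  have hfx := hfs.comp_hasDerivAt z.re hx
  have hfy := hfs.comp_hasDerivAt z.im hy
  simp only [Function.comp_def, sliceMap_mk, ContinuousLinearMap.comp_apply, sliceMap_one,
    sliceMap_I] at hfx hfy
  rw [dbar, hfx.deriv, hfy.deriv]

theorem IsSliceRegular.fderiv_apply {f : ℍ[ℝ] → ℍ[ℝ]} (hf : IsSliceRegular f)
    (hI : I ∈ imaginaryUnits) (z : ℂ) :
    fderiv ℝ f (sliceMap I z) I = I * fderiv ℝ f (sliceMap I z) 1 := by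
  have hdbar := hf.2 I hI z.re z.im
  rw [dbar_eq_smul_fderiv hf.1, smul_eq_zero_iff_right (by norm_num),
    add_eq_zero_iff_eq_neg] at hdbar
  rw [hdbar, mul_neg, mul_mul_of_mem_imaginaryUnits hI, neg_neg]

theorem isSliceRegular_mul_add (a b : ℍ[ℝ]) : IsSliceRegular fun q => q * a + b := by
  have hd : Differentiable ℝ fun q : ℍ[ℝ] => q * a + b := by fun_prop
  refine ⟨hd, fun I hI x y => ?_⟩
  have hfderiv (q : ℍ[ℝ]) : HasFDerivAt (fun q : ℍ[ℝ] => q * a + b)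
      ((ContinuousLinearMap.mul ℝ ℍ[ℝ]).flip a) q :=
    ((ContinuousLinearMap.mul ℝ ℍ[ℝ]).flip a).hasFDerivAt.add_const b
  have h := dbar_eq_smul_fderiv hd I ⟨x, y⟩
  rw [(hfderiv _).fderiv] at h
  simpa [mul_mul_of_mem_imaginaryUnits hI] using h

/-- The functional `q ↦ ⟪v, q⟫ - i ⟪v, I q⟫`. For `I² = -1` it is the complexification of `⟪v, ·⟫`
with respect to the complex structure given by left multiplication by `I`; its values at all `v`
turn `ℍ`-valued statements on the slice `ℝ + Iℝ` into scalar ones. -/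
noncomputable def sliceFunctional (I v : ℍ[ℝ]) : ℍ[ℝ] →L[ℝ] ℂ :=
  Complex.ofRealCLM ∘L innerSL ℝ v -
    Complex.I • (Complex.ofRealCLM ∘L innerSL ℝ v ∘L ContinuousLinearMap.mul ℝ ℍ[ℝ] I)

theorem sliceFunctional_apply (I v q : ℍ[ℝ]) :
    sliceFunctional I v q = (⟪v, q⟫_ℝ : ℂ) - Complex.I * (⟪v, I * q⟫_ℝ : ℂ) := rfl

theorem sliceFunctional_re (I v q : ℍ[ℝ]) : (sliceFunctional I v q).re = ⟪v, q⟫_ℝ := by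
  simp [sliceFunctional_apply]

theorem eq_of_forall_sliceFunctional_eq {p q : ℍ[ℝ]}
    (h : ∀ v, sliceFunctional I v p = sliceFunctional I v q) : p = q :=
  ext_inner_left ℝ fun v => by rw [← sliceFunctional_re I, h, sliceFunctional_re]

theorem sliceFunctional_mul (hI : I ∈ imaginaryUnits) (v q : ℍ[ℝ]) :
    sliceFunctional I v (I * q) = Complex.I * sliceFunctional I v q := by
  rw [sliceFunctional_apply, sliceFunctional_apply, mul_mul_of_mem_imaginaryUnits hI,
    inner_neg_right, Complex.ofReal_neg]
  linear_combination (⟪v, I * q⟫_ℝ : ℂ) * Complex.I_sq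

theorem sliceFunctional_sliceMap_mul (hI : I ∈ imaginaryUnits) (v : ℍ[ℝ]) (z : ℂ) (q : ℍ[ℝ]) :
    sliceFunctional I v (sliceMap I z * q) = z * sliceFunctional I v q := by
  rw [sliceMap_apply, add_mul, smul_mul_assoc, smul_mul_assoc, one_mul, map_add, map_smul, map_smul,
    sliceFunctional_mul hI, Complex.real_smul, Complex.real_smul, ← mul_assoc, ← add_mul,
    Complex.re_add_im]

theorem IsSliceRegular.differentiable_sliceFunctional {f : ℍ[ℝ] → ℍ[ℝ]} (hf : IsSliceRegular f)
    (hI : I ∈ imaginaryUnits) (v : ℍ[ℝ]) :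
    Differentiable ℂ fun z => sliceFunctional I v (f (sliceMap I z)) := by
  intro z
  have hfderiv : HasFDerivAt (fun z => sliceFunctional I v (f (sliceMap I z)))
      (sliceFunctional I v ∘L fderiv ℝ f (sliceMap I z) ∘L sliceMap I) z :=
    (sliceFunctional I v).hasFDerivAt.comp z
      ((hf.1 _).hasFDerivAt.comp z (sliceMap I).hasFDerivAt)
  rw [differentiableAt_complex_iff_differentiableAt_real]
  refine ⟨hfderiv.differentiableAt, ?_⟩
  simp only [hfderiv.fderiv, ContinuousLinearMap.comp_apply, sliceMap_I, sliceMap_one,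
    hf.fderiv_apply hI, sliceFunctional_mul hI, smul_eq_mul]

theorem IsSliceRegular.eq_of_forall_coe_eq {f g : ℍ[ℝ] → ℍ[ℝ]} (hf : IsSliceRegular f)
    (hg : IsSliceRegular g) (h : ∀ t : ℝ, f t = g t) : f = g := by
  funext q
  obtain ⟨I, hI, z, rfl⟩ := exists_sliceMap_eq q
  refine eq_of_forall_sliceFunctional_eq (I := I) fun v => ?_
  exact congrFun (eq_of_forall_ofReal_eq (hf.differentiable_sliceFunctional hI v)
    (hg.differentiable_sliceFunctional hI v) fun t => by simp only [sliceMap_ofReal, h]) z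

theorem exists_norm_add_mul_norm_sub_eq (α β : ℍ[ℝ]) : ∃ I ∈ imaginaryUnits,
    ‖α + I * β‖ * ‖α - I * β‖ = ‖(⟨‖α‖ ^ 2 - ‖β‖ ^ 2, 2 * ⟪α, β⟫_ℝ⟩ : ℂ)‖ := by
  -- `I` spans the slice of `α * star β`, so that `⟪α, I * β⟫` is the whole imaginary part.
  obtain ⟨I, hI, z, hz⟩ := exists_sliceMap_eq (α * star β)
  have hnorm : ‖α‖ * ‖β‖ = ‖z‖ := by
    rw [← norm_sliceMap hI, hz, norm_mul, Quaternion.norm_star]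
  have hre : ⟪α, β⟫_ℝ = z.re := by
    have h := inner_sliceMap hI z 1
    rw [hz, sliceMap_one, Quaternion.inner_def, star_one, mul_one] at h
    simpa [Quaternion.inner_def, Complex.inner] using h
  have him : ⟪α, I * β⟫_ℝ = z.im := by
    have h := inner_sliceMap hI z Complex.I
    rw [hz, sliceMap_I, Quaternion.inner_def, mul_assoc, ← star_mul] at h
    simpa [Quaternion.inner_def, Complex.inner] using h
  have hz_sq : (‖α‖ * ‖β‖) ^ 2 = z.re ^ 2 + z.im ^ 2 := by
    rw [hnorm, Complex.sq_norm, Complex.normSq_apply, pow_two, pow_two]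
  refine ⟨I, hI, (sq_eq_sq₀ (by positivity) (norm_nonneg _)).1 ?_⟩
  rw [norm_add_mul_norm_sub_sq, norm_mul, (mem_imaginaryUnits_iff.1 hI).2, one_mul, him, hre,
    Complex.sq_norm, Complex.normSq_mk]
  linear_combination 4 * hz_sq

theorem exists_norm_add_mul_sq_le (α β : ℍ[ℝ]) : ∃ I ∈ imaginaryUnits,
    ‖α + I * β‖ ^ 2 ≤ ‖(⟨‖α‖ ^ 2 - ‖β‖ ^ 2, 2 * ⟪α, β⟫_ℝ⟩ : ℂ)‖ := by
  obtain ⟨I, hI, h⟩ := exists_norm_add_mul_norm_sub_eq α β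
  rw [← h]
  rcases le_total ‖α + I * β‖ ‖α - I * β‖ with hle | hle
  · exact ⟨I, hI, by rw [pow_two]; gcongr⟩
  · refine ⟨-I, neg_mem_imaginaryUnits hI, ?_⟩
    rw [neg_mul, ← sub_eq_add_neg, pow_two]
    gcongr

section Coordinates

variable {ι : Type*} [Fintype ι]

variable (b : OrthonormalBasis ι ℝ ℍ[ℝ])

theorem exists_norm_sum_sliceMap_mul_sq_le (w : ι → ℂ) : ∃ I ∈ imaginaryUnits,
    ‖∑ k, sliceMap I (w k) * b k‖ ^ 2 ≤ ‖∑ k, w k ^ 2‖ := by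
  obtain ⟨I, hI, h⟩ := exists_norm_add_mul_sq_le (∑ k, (w k).re • b k) (∑ k, (w k).im • b k)
  refine ⟨I, hI, ?_⟩
  have hsum : ∑ k, sliceMap I (w k) * b k =
      ∑ k, (w k).re • b k + I * ∑ k, (w k).im • b k := by
    simp only [sliceMap_apply, add_mul, smul_mul_assoc, one_mul, Finset.sum_add_distrib,
      Finset.mul_sum, mul_smul_comm]
  rwa [hsum, sum_sq_eq_mk_norm_inner b.orthonormal]

/-- `F` is the stem function of `f`, written in the coordinates of `b`: an entire function with
values in `ℍ ⊗ ℂ`, real on the real axis, from which `f` is recovered on each slice `ℝ + Iℝ` by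
replacing the complex unit `i` by `I`. -/
structure IsStem (f : ℍ[ℝ] → ℍ[ℝ]) (F : ι → ℂ → ℂ) : Prop where
  differentiable (k : ι) : Differentiable ℂ (F k)
  apply_ofReal (k : ι) (t : ℝ) : F k t = ⟪b k, f t⟫_ℝ
  apply_sliceMap {I : ℍ[ℝ]} (hI : I ∈ imaginaryUnits) (z : ℂ) :
    f (sliceMap I z) = ∑ k, sliceMap I (F k z) * b k

/-- The symmetrization `(f - c)ˢ` of `f - c`, for a function `f` with stem function `F`. It is an
entire function vanishing at `x + iy` exactly when `f` takes the value `c` on the sphere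
`x + 𝕊y`. -/
noncomputable def symmetrization (F : ι → ℂ → ℂ) (c : ℍ[ℝ]) (z : ℂ) : ℂ :=
  ∑ k, (F k z - ⟪b k, c⟫_ℝ) ^ 2

/-- The quotient of the symmetrization of `f - f t` by `(z - t) ^ 2`, for a function `f` with stem
function `F` and a real point `t`. -/
noncomputable def symmetrizationQuotient (F : ι → ℂ → ℂ) (t : ℝ) (z : ℂ) : ℂ :=
  ∑ k, dslope (F k) t z ^ 2

variable {b} {f : ℍ[ℝ] → ℍ[ℝ]} {F : ι → ℂ → ℂ}

theorem IsSliceRegular.exists_isStem (hf : IsSliceRegular f) (b : OrthonormalBasis ι ℝ ℍ[ℝ]) :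
    ∃ F, IsStem b f F := by
  obtain ⟨J, hJ⟩ := imaginaryUnits_nonempty
  choose F hF hFre using fun k =>
    exists_differentiable_forall_ofReal_eq_re (hf.differentiable_sliceFunctional hJ (b k))
  have hreal (k : ι) (t : ℝ) : F k t = ⟪b k, f t⟫_ℝ := by
    rw [hFre, sliceFunctional_re, sliceMap_ofReal]
  refine ⟨F, hF, hreal, fun {I} hI z => eq_of_forall_sliceFunctional_eq (I := I) fun v => ?_⟩
  simp only [map_sum, sliceFunctional_sliceMap_mul hI]
  refine congrFun (eq_of_forall_ofReal_eq (hf.differentiable_sliceFunctional hI v)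
    (Differentiable.fun_sum fun k _ => (hF k).mul_const _) fun t => ?_) z
  conv_lhs => rw [sliceMap_ofReal, ← b.sum_repr' (f t), map_sum]
  exact Finset.sum_congr rfl fun k _ => by rw [map_smul, Complex.real_smul, hreal]

namespace IsStem

theorem exists_norm_sub_sq_le (hF : IsStem b f F) (c : ℍ[ℝ]) (z : ℂ) :
    ∃ I ∈ imaginaryUnits, ‖f (sliceMap I z) - c‖ ^ 2 ≤ ‖symmetrization b F c z‖ := by
  obtain ⟨I, hI, h⟩ := exists_norm_sum_sliceMap_mul_sq_le b fun k => F k z - ⟪b k, c⟫_ℝ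
  refine ⟨I, hI, ?_⟩
  simpa only [symmetrization, map_sub, sub_mul, Finset.sum_sub_distrib, ← hF.apply_sliceMap hI,
    sliceMap_ofReal, Quaternion.coe_mul_eq_smul, b.sum_repr'] using h

theorem exists_eq_of_symmetrization_eq_zero (hF : IsStem b f F) {c : ℍ[ℝ]} {z : ℂ}
    (h : symmetrization b F c z = 0) : ∃ I ∈ imaginaryUnits, f (sliceMap I z) = c := by
  obtain ⟨I, hI, hle⟩ := hF.exists_norm_sub_sq_le c z
  rw [h, norm_zero] at hle
  exact ⟨I, hI, by simpa [sub_eq_zero] using hle.antisymm (sq_nonneg _)⟩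

theorem symmetrization_ofReal (hF : IsStem b f F) (c : ℍ[ℝ]) (t : ℝ) :
    symmetrization b F c t = (‖f t - c‖ ^ 2 : ℝ) := by
  simp only [symmetrization, hF.apply_ofReal, ← Complex.ofReal_sub, ← inner_sub_right]
  exact_mod_cast b.sum_sq_inner_right _

theorem symmetrization_eq_mul (hF : IsStem b f F) (t : ℝ) (z : ℂ) :
    symmetrization b F (f t) z = (z - t) ^ 2 * symmetrizationQuotient F t z := by
  simp only [symmetrization, symmetrizationQuotient, ← hF.apply_ofReal, ← sub_smul_dslope,
    smul_eq_mul, mul_pow, Finset.mul_sum]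

theorem deriv_ofReal (hF : IsStem b f F) (hf : Differentiable ℝ f) (k : ι) (t : ℝ) :
    deriv (F k) t = ⟪b k, deriv (fun s : ℝ => f s) t⟫_ℝ := by
  have hcurve := (differentiable_comp_coe hf t).hasDerivAt
  have hinner := (Complex.ofRealCLM ∘L innerSL ℝ (b k)).hasFDerivAt.comp_hasDerivAt t hcurve
  refine ((hF.differentiable k t).hasDerivAt.comp_ofReal).unique ?_
  simpa [Function.comp_def, ← hF.apply_ofReal] using hinner

theorem symmetrizationQuotient_self (hF : IsStem b f F) (hf : Differentiable ℝ f) (t : ℝ) :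
    symmetrizationQuotient F t t = (‖deriv (fun s : ℝ => f s) t‖ ^ 2 : ℝ) := by
  simp only [symmetrizationQuotient, dslope_same, hF.deriv_ofReal hf]
  exact_mod_cast b.sum_sq_inner_right _

theorem eq_ofReal_of_symmetrization_eq_zero (hF : IsStem b f F) (hinj : Function.Injective f)
    {t : ℝ} {z : ℂ} (h : symmetrization b F (f t) z = 0) : z = t := by
  obtain ⟨I, hI, hz⟩ := hF.exists_eq_of_symmetrization_eq_zero h
  rw [← sub_eq_zero, ← norm_eq_zero, ← norm_sliceMap_sub_coe hI, hinj hz, sub_self, norm_zero]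

theorem image_closedBall_mem_nhds (hF : IsStem b f F) (hinj : Function.Injective f) (t : ℝ)
    {r : ℝ} (hr : 0 < r) : f '' Metric.closedBall (t : ℍ[ℝ]) r ∈ 𝓝 (f t) := by
  have hd := hF.differentiable
  have hcont : Continuous fun p : ℍ[ℝ] × ℂ => symmetrization b F p.1 p.2 := by
    refine continuous_finsetSum _ fun k _ => ?_
    have := (hd k).continuous
    fun_prop
  have hdiff (c : ℍ[ℝ]) : Differentiable ℂ (symmetrization b F c) :=
    Differentiable.fun_sum fun k _ => ((hd k).sub_const _).pow 2
  have hzero : symmetrization b F (f t) t = 0 := by simp [hF.symmetrization_ofReal]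
  have hsphere : ∀ z ∈ Metric.sphere (t : ℂ) r, symmetrization b F (f t) z ≠ 0 := fun z hz h =>
    Metric.ne_of_mem_sphere hz hr.ne' (hF.eq_ofReal_of_symmetrization_eq_zero hinj h)
  filter_upwards [eventually_exists_mem_closedBall_eq_zero hcont hdiff hr hzero hsphere]
    with c ⟨z, hz, hcz⟩
  obtain ⟨I, hI, rfl⟩ := hF.exists_eq_of_symmetrization_eq_zero hcz
  refine ⟨sliceMap I z, ?_, rfl⟩
  rwa [mem_closedBall_iff_norm, norm_sliceMap_sub_coe hI, ← mem_closedBall_iff_norm]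

theorem exists_le_norm_sub (hF : IsStem b f F) (hinj : Function.Injective f) (t : ℝ) :
    ∃ δ > 0, ∀ q : ℍ[ℝ], 1 < ‖q - t‖ → δ ≤ ‖f q - f t‖ := by
  obtain ⟨δ, hδ, hball⟩ := Metric.mem_nhds_iff.1 (hF.image_closedBall_mem_nhds hinj t one_pos)
  refine ⟨δ, hδ, fun q hq => ?_⟩
  by_contra! hlt
  obtain ⟨p, hp, hpq⟩ := hball (mem_ball_iff_norm.2 hlt)
  rw [hinj hpq, mem_closedBall_iff_norm] at hp
  exact hq.not_ge hp

theorem symmetrizationQuotient_ne_zero (hF : IsStem b f F) (hf : Differentiable ℝ f)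
    (hinj : Function.Injective f) {t : ℝ} (ht : deriv (fun s : ℝ => f s) t ≠ 0) (z : ℂ) :
    symmetrizationQuotient F t z ≠ 0 := fun h => by
  obtain rfl : z = t :=
    hF.eq_ofReal_of_symmetrization_eq_zero hinj (by rw [hF.symmetrization_eq_mul, h, mul_zero])
  rw [hF.symmetrizationQuotient_self hf] at h
  simp [ht] at h

theorem isBigO_inv_symmetrizationQuotient (hF : IsStem b f F) (hinj : Function.Injective f)
    (t : ℝ) : (fun z => (symmetrizationQuotient F t z)⁻¹) =O[Bornology.cobounded ℂ] (· ^ 2) := by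
  obtain ⟨δ, hδ, hfar⟩ := hF.exists_le_norm_sub hinj t
  have hshift : (fun z : ℂ => (z - t) ^ 2) =O[Bornology.cobounded ℂ] (· ^ 2) :=
    ((Asymptotics.isBigO_refl id _).sub (Asymptotics.isLittleO_const_id_cobounded _).isBigO).pow 2
  refine Asymptotics.IsBigO.trans (Asymptotics.IsBigO.of_bound (δ ^ 2)⁻¹ ?_) hshift
  have hlarge : ∀ᶠ z : ℂ in Bornology.cobounded ℂ, 1 < ‖z - t‖ := by
    have : (Metric.closedBall (t : ℂ) 1)ᶜ ∈ Bornology.cobounded ℂ :=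
      Metric.isBounded_closedBall.compl
    filter_upwards [this] with z hz
    rwa [Set.mem_compl_iff, mem_closedBall_iff_norm, not_le] at hz
  filter_upwards [hlarge] with z hz
  obtain ⟨I, hI, hle⟩ := hF.exists_norm_sub_sq_le (f t) z
  have hδz : δ ^ 2 ≤ ‖(z - t) ^ 2‖ * ‖symmetrizationQuotient F t z‖ := by
    rw [← norm_mul, ← hF.symmetrization_eq_mul]
    refine le_trans ?_ hle
    gcongr
    exact hfar _ (by rwa [norm_sliceMap_sub_coe hI])
  have hpos : 0 < ‖symmetrizationQuotient F t z‖ :=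
    pos_of_mul_pos_right ((by positivity : 0 < δ ^ 2).trans_le hδz) (norm_nonneg _)
  rwa [norm_inv, inv_mul_eq_div, inv_le_iff_one_le_mul₀ hpos, div_mul_eq_mul_div,
    one_le_div₀ (by positivity)]

theorem symmetrizationQuotient_eq_self (hF : IsStem b f F) (hf : Differentiable ℝ f)
    (hinj : Function.Injective f) {t : ℝ} (ht : deriv (fun s : ℝ => f s) t ≠ 0) (z : ℂ) :
    symmetrizationQuotient F t z = symmetrizationQuotient F t t := by
  have hne := hF.symmetrizationQuotient_ne_zero hf hinj ht
  have hdiff : Differentiable ℂ (symmetrizationQuotient F t) :=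
    Differentiable.fun_sum fun k _ => (differentiable_dslope (hF.differentiable k) t).pow 2
  exact inv_injective (apply_eq_apply_of_ne_zero_of_isBigO_pow (hdiff.inv hne)
    (fun z => inv_ne_zero (hne z)) (hF.isBigO_inv_symmetrizationQuotient hinj t) z t)

theorem norm_sub_eq (hF : IsStem b f F) (hf : Differentiable ℝ f)
    (hinj : Function.Injective f) {t : ℝ} (ht : deriv (fun s : ℝ => f s) t ≠ 0) (s : ℝ) :
    ‖f s - f t‖ = ‖deriv (fun s : ℝ => f s) t‖ * |s - t| := by
  have h := hF.symmetrization_eq_mul t s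
  rw [hF.symmetrization_ofReal, hF.symmetrizationQuotient_eq_self hf hinj ht,
    hF.symmetrizationQuotient_self hf] at h
  rw [← sq_eq_sq₀ (norm_nonneg _) (by positivity), mul_pow, sq_abs, mul_comm]
  exact_mod_cast h

end IsStem

end Coordinates

theorem IsSliceRegular.isRegularAffine_of_injective {f : ℍ[ℝ] → ℍ[ℝ]} (hf : IsSliceRegular f)
    (hinj : Function.Injective f) : IsRegularAffine f := by
  have hcurve := differentiable_comp_coe hf.1
  have hcurve_inj : Function.Injective fun t : ℝ => f t := hinj.comp Quaternion.coe_injective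
  obtain ⟨F, hF⟩ := hf.exists_isStem (stdOrthonormalBasis ℝ ℍ[ℝ])
  obtain ⟨t, ht, hft⟩ := exists_deriv_ne_zero_of_ne hcurve zero_le_one (hcurve_inj.ne zero_ne_one)
  obtain ⟨u, hu, hfu⟩ :=
    exists_deriv_ne_zero_of_ne hcurve one_le_two (hcurve_inj.ne one_lt_two.ne)
  obtain ⟨a, b, hab⟩ := exists_eq_smul_add_of_norm_sub_eq (ht.2.trans_le hu.1).ne
    (hF.norm_sub_eq hf.1 hinj hft) (hF.norm_sub_eq hf.1 hinj hfu)
  have hf_eq : f = fun q => q * a + b :=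
    hf.eq_of_forall_coe_eq (isSliceRegular_mul_add a b) fun s => by
      rw [hab, Quaternion.coe_mul_eq_smul]
  refine ⟨a, b, fun ha => ?_, congrFun hf_eq⟩
  exact zero_ne_one (hinj (show f 0 = f 1 by simp [hf_eq, ha]))

theorem IsRegularAffine.isSliceRegular {f : ℍ[ℝ] → ℍ[ℝ]} (hf : IsRegularAffine f) :
    IsSliceRegular f := by
  obtain ⟨a, b, -, h⟩ := hf
  exact funext h ▸ isSliceRegular_mul_add a b

theorem IsRegularAffine.isBiregular {f : ℍ[ℝ] → ℍ[ℝ]} (hf : IsRegularAffine f) :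
    IsBiregular f := by
  refine ⟨hf.isSliceRegular, ?_⟩
  obtain ⟨a, b, ha, h⟩ := hf
  refine ⟨fun q => q * a⁻¹ + -(b * a⁻¹), isSliceRegular_mul_add _ _, fun q => ?_, fun q => ?_⟩
  · simp only [h, add_mul, mul_inv_cancel_right₀ ha, add_neg_cancel_right]
  · rw [h, add_mul, neg_mul, inv_mul_cancel_right₀ ha, inv_mul_cancel_right₀ ha,
      neg_add_cancel_right]

theorem IsBiregular.injective {f : ℍ[ℝ] → ℍ[ℝ]} (hf : IsBiregular f) : Function.Injective f :=
  let ⟨_, _, _, hg, _⟩ := hf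
  hg.injective

theorem isSliceRegular_and_injective_iff {f : ℍ[ℝ] → ℍ[ℝ]} :
    IsSliceRegular f ∧ Function.Injective f ↔ IsRegularAffine f :=
  ⟨fun h => h.1.isRegularAffine_of_injective h.2,
    fun h => ⟨h.isSliceRegular, h.isBiregular.injective⟩⟩

theorem isBiregular_iff_isRegularAffine {f : ℍ[ℝ] → ℍ[ℝ]} :
    IsBiregular f ↔ IsRegularAffine f :=
  ⟨fun h => h.1.isRegularAffine_of_injective h.injective, fun h => h.isBiregular⟩

end SliceRegular

theorem theorem3p4 :
    (∀ f : ℍ[ℝ] → ℍ[ℝ],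
      (SliceRegular.IsSliceRegular f ∧ Function.Injective f) ↔
        ∃ a b : ℍ[ℝ], a ≠ 0 ∧ ∀ q : ℍ[ℝ], f q = q * a + b) ∧
    (∀ f : ℍ[ℝ] → ℍ[ℝ], SliceRegular.IsBiregular f ↔ SliceRegular.IsRegularAffine f) ∧
    SliceRegular.aut = (SliceRegular.affineGroup : Set (Equiv.Perm ℍ[ℝ])) :=
  ⟨fun _ => SliceRegular.isSliceRegular_and_injective_iff,
    fun _ => SliceRegular.isBiregular_iff_isRegularAffine,
    Set.ext fun _ => SliceRegular.isBiregular_iff_isRegularAffine⟩
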